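/- Let $L \in \mathbb{Q}\setminus\{0,1\}$ be such that $L^2-L+1$ is the square of a rational number, and let $E_L$ be the elliptic curve over $\mathbb{Q}$ given by $y^2 = x(x-1)(x-L)$. Then none of $L$, $1-L$, $L^2-L$ is the square of a rational number. Moreover, for every quadratic extension $K/\mathbb{Q}$, the group $E_L(K)$ has a point of (exact) order $4$ if and only if $K = \mathbb{Q}(\sqrt{1-L})$, i.e. if and only if $K$ is generated over $\mathbb{Q}$ by a square root of $1-L$. -/

import Mathlib

/-- The parameter `L` is nice: `L` is a rational number other than `0` and `1`, and
`L ^ 2 - L + 1` is the square of a rational number. -/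
def IsNiceParameter (L : ℚ) : Prop :=
  L ≠ 0 ∧ L ≠ 1 ∧ IsSquare (L ^ 2 - L + 1)

/-- The curve `E_L : y ^ 2 = x (x - 1) (x - L) = x ^ 3 - (1 + L) x ^ 2 + L x` over `ℚ`. -/
def niceCurve (L : ℚ) : WeierstrassCurve ℚ where
  a₁ := 0
  a₂ := -(1 + L)
  a₃ := 0
  a₄ := L
  a₆ := 0

/-- The field extension `K` of `ℚ` is `ℚ(√d)`: it is generated over `ℚ` by a square root of `d`. -/
def IsRatAdjoinSqrt (K : Type*) [Field K] [Algebra ℚ K] (d : ℚ) : Prop :=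
  ∃ α : K, α ^ 2 = algebraMap ℚ K d ∧ IntermediateField.adjoin ℚ {α} = ⊤

/-! If `P` has order 4, then `2P` is `(e, 0)` with `e` one of 0, 1, `L`, and subtracting each root
from its abscissa gives squares in `K`. So either -1 and `-L`, or `1 - L`, or `L` and `L - 1` are
squares in `K`. A rational square in `ℚ(√d)` is a square or `d` times a square in `ℚ`, so the first
and third cases would make one of `±L`, `L - 1`, `L ^ 2 - L` a rational square.

Niceness forbids this: `L = ±s ^ 2` makes `s ^ 4 ∓ s ^ 2 + 1` a square, and infinite descent leaves
only trivial solutions. The symmetries `L ↦ 1 - L` and `L ↦ L⁻¹` preserve niceness and give the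
other cases. Conversely, a square root of `1 - L` gives an explicit point that doubles to `(1, 0)`.
-/

/-! ### Integer arithmetic for the descents -/

/-- Two factorisations `x y = m n` with `x` nonzero have a common refinement. -/
theorem Int.exists_common_refinement {x y m n : ℤ} (hx : x ≠ 0) (h : x * y = m * n) :
    ∃ a b c d : ℤ, x = a * b ∧ y = c * d ∧ m = a * c ∧ n = b * d := by
  obtain ⟨a, b, ⟨c, rfl⟩, ⟨d, rfl⟩, rfl⟩ := exists_dvd_and_dvd_of_dvd_mul (Dvd.intro _ h)
  refine ⟨a, b, c, d, rfl, ?_, rfl, rfl⟩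
  exact mul_left_cancel₀ hx (by linear_combination h)

theorem IsCoprime.of_eq_add_mul {u v w : ℤ} (t : ℤ) (h : IsCoprime u v) (e : w = u + v * t) :
    IsCoprime w v :=
  e ▸ h.add_mul_left_left t

/-- Eliminating `d ^ 2` or `a ^ 2` shows that `k` divides both `3 * a ^ 2` and `3 * d ^ 2`. The
signs `ε = 1` and `ε = -1` serve the two descents. -/
theorem Int.dvd_three_of_quadratic_forms {a d k s t : ℤ} (ε : ℤ) (had : IsCoprime a d)
    (h₁ : 4 * a ^ 2 + ε * d ^ 2 = k * s) (h₂ : a ^ 2 + ε * d ^ 2 = k * t) (hε : ε ^ 2 = 1) :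
    k ∣ 3 := by
  have h₃ : k ∣ 3 * a ^ 2 := ⟨s - t, by linear_combination h₁ - h₂⟩
  have h₄ : k ∣ 3 * d ^ 2 :=
    ⟨ε * (4 * t - s), by linear_combination ε * (4 * h₂ - h₁) - 3 * d ^ 2 * hε⟩
  obtain ⟨u, v, huv⟩ := had.pow (m := 2) (n := 2)
  have : (3 : ℤ) = u * (3 * a ^ 2) + v * (3 * d ^ 2) := by linear_combination -3 * huv
  rw [this]
  exact dvd_add (h₃.mul_left _) (h₄.mul_left _)

theorem Int.eq_of_dvd_three {k : ℤ} (h : k ∣ 3) : k = 1 ∨ k = -1 ∨ k = 3 ∨ k = -3 := by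
  have h₁ := Int.le_of_dvd (by norm_num) h
  have h₂ := Int.le_of_dvd (by norm_num) ((neg_dvd).2 h)
  have : -3 ≤ k := by linarith
  interval_cases k <;> revert h <;> decide

theorem Int.isCoprime_of_two_mul {x y : ℤ} (h : IsCoprime (2 * x) y) :
    IsCoprime x y ∧ y % 2 = 1 := by
  refine ⟨h.of_mul_left_right, ?_⟩
  rcases Int.emod_two_eq_zero_or_one y with h0 | h1
  · obtain ⟨u, v, huv⟩ := h.of_mul_left_left
    have := Int.emod_add_mul_ediv y 2
    rw [h0] at this
    rw [← this] at huv
    ring_nf at huv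
    omega
  · exact h1

theorem Int.sq_emod_four (c : ℤ) : c ^ 2 % 4 = 0 ∧ c % 2 = 0 ∨ c ^ 2 % 4 = 1 ∧ c % 2 = 1 := by
  have h : c % 4 = 0 ∨ c % 4 = 1 ∨ c % 4 = 2 ∨ c % 4 = 3 := by omega
  rcases h with h | h | h | h <;> simp [pow_two, Int.mul_emod, h] <;> omega

theorem Int.natAbs_lt_of_eq_mul {x e t : ℤ} (hx : x ≠ 0) (h : x = 2 * (e * t)) :
    e.natAbs < x.natAbs := by
  subst h
  have h1 : e ≠ 0 := by rintro rfl; simp at hx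
  have h2 : t ≠ 0 := by rintro rfl; simp at hx
  have := Int.natAbs_pos.2 h1
  have := Int.natAbs_pos.2 h2
  rw [Int.natAbs_mul, Int.natAbs_mul]
  have : e.natAbs * 1 ≤ e.natAbs * t.natAbs := Nat.mul_le_mul_left _ this
  simp only [Int.reduceAbs]
  omega

/-- Parametrisation of coprime Pythagorean triples with odd first leg, with no sign condition. -/
theorem Int.exists_parametrization_of_sq_add_sq {p q r : ℤ} (h : p ^ 2 + q ^ 2 = r ^ 2)
    (hpq : IsCoprime p q) (hp : p % 2 = 1) :
    ∃ m n : ℤ, p = m ^ 2 - n ^ 2 ∧ q = 2 * (m * n) ∧ r ^ 2 = (m ^ 2 + n ^ 2) ^ 2 ∧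
      IsCoprime m n ∧ (m % 2 = 0 ∧ n % 2 = 1 ∨ m % 2 = 1 ∧ n % 2 = 0) := by
  have hr : r ≠ 0 := by
    rintro rfl
    have : p = 0 := by nlinarith [sq_nonneg p, sq_nonneg q]
    subst this
    simp at hp
  have ht : PythagoreanTriple p q |r| := by
    unfold PythagoreanTriple
    rw [abs_mul_abs_self]
    linear_combination h
  obtain ⟨m, n, h1, h2, h3, h4, h5, -⟩ :=
    ht.coprime_classification' (Int.isCoprime_iff_gcd_eq_one.1 hpq) hp (abs_pos.2 hr)
  exact ⟨m, n, h1, by rw [h2]; ring, by rw [← h3, sq_abs],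
    Int.isCoprime_iff_gcd_eq_one.2 h4, h5⟩

/-! ### Infinite descent on the two quartics -/

/-- The equation reads `(x ^ 2 - y ^ 2) ^ 2 + (x * y) ^ 2 = z ^ 2`. Parametrising this triple, and
then a second one, yields a solution whose even entry is smaller. -/
theorem Int.quartic_minus_descent (N : ℕ) : ∀ x y z : ℤ, x.natAbs = N → x ≠ 0 → x % 2 = 0 →
    IsCoprime x y → x ^ 4 - x ^ 2 * y ^ 2 + y ^ 4 ≠ z ^ 2 := by
  induction N using Nat.strong_induction_on with
  | _ N ih =>
  intro x y z hN hx hx2 hxy hz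
  obtain ⟨w, rfl⟩ : ∃ w, x = 2 * w := ⟨x / 2, by omega⟩
  obtain ⟨hwy, hy⟩ := Int.isCoprime_of_two_mul hxy
  have hw : w ≠ 0 := by rintro rfl; simp at hx
  have hcop : IsCoprime ((2 * w) ^ 2 - y ^ 2) (2 * w * y) := by
    refine IsCoprime.mul_right ?_ ?_
    · exact (hxy.symm.neg_left.mul_left hxy.symm).of_eq_add_mul (2 * w) (by ring)
    · exact (hxy.mul_left hxy).of_eq_add_mul (-y) (by ring)
  have hodd : ((2 * w) ^ 2 - y ^ 2) % 2 = 1 := by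
    have h1 := Int.sq_emod_four y
    have h2 : (2 * w) ^ 2 = 2 * (2 * w ^ 2) := by ring
    omega
  obtain ⟨m, n, h1, h2, -, hmn, -⟩ := Int.exists_parametrization_of_sq_add_sq
    (r := z) (by linear_combination hz) hcop hodd
  obtain ⟨a, b, c, d, rfl, rfl, rfl, rfl⟩ :=
    Int.exists_common_refinement (x := w) (y := y) (m := m) (n := n) hw
      (by linarith)
  have hbc : IsCoprime (c ^ 2) (b ^ 2) :=
    (hwy.of_mul_left_right.of_mul_right_left.symm).pow
  have had : IsCoprime a d := hwy.of_mul_left_left.of_mul_right_right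
  have ha : a ≠ 0 := left_ne_zero_of_mul hw
  have key : b ^ 2 * (4 * a ^ 2 + 1 * d ^ 2) = c ^ 2 * (a ^ 2 + 1 * d ^ 2) := by
    linear_combination h1
  obtain ⟨k, hk⟩ := hbc.dvd_of_dvd_mul_left (Dvd.intro _ key.symm)
  rw [mul_comm (c ^ 2) k] at hk
  have hc : c ≠ 0 := by rintro rfl; simp at hy
  have hk' : a ^ 2 + 1 * d ^ 2 = k * b ^ 2 := by
    refine mul_left_cancel₀ (pow_ne_zero 2 hc) ?_
    rw [← key, hk]; ring
  have ha2 : 0 < a ^ 2 := by positivity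
  have hkpos : 0 < k := by
    refine pos_of_mul_pos_left (b := b ^ 2) ?_ (sq_nonneg b)
    rw [← hk']; positivity
  have hd : d % 2 = 1 := by
    rcases Int.emod_two_eq_zero_or_one d with h | h
    · simp [Int.mul_emod, h] at hy
    · exact h
  have hk3 := Int.eq_of_dvd_three (Int.dvd_three_of_quadratic_forms 1 had hk hk' (by norm_num))
  obtain rfl | rfl : k = 1 ∨ k = 3 := by omega
  · have hda : IsCoprime d (2 * a) := by
      refine IsCoprime.mul_right ?_ had.symm
      exact ⟨1, -(d / 2), by have := Int.emod_add_mul_ediv d 2; linarith⟩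
    obtain ⟨R, S, e1, e2, -, hRS, hpar⟩ := Int.exists_parametrization_of_sq_add_sq
      (p := d) (q := 2 * a) (r := c) (by linear_combination hk) hda hd
    obtain rfl : a = R * S := by linarith
    rcases hpar with ⟨h, -⟩ | ⟨-, h⟩
    · refine ih R.natAbs ?_ R S b rfl (left_ne_zero_of_mul ha) h hRS ?_
      · rw [← hN]; exact Int.natAbs_lt_of_eq_mul (t := S * b) hx (by ring)
      · rw [e1] at hk'; linear_combination hk'
    · refine ih S.natAbs ?_ S R b rfl (right_ne_zero_of_mul ha) h hRS.symm ?_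
      · rw [← hN]; exact Int.natAbs_lt_of_eq_mul (t := R * b) hx (by ring)
      · rw [e1] at hk'; linear_combination hk'
  -- Since -1 is not a square mod 3, 3 would divide both `a` and `d`.
  · have h3 : (a ^ 2 + d ^ 2) % 3 = 0 := by omega
    obtain ⟨u, v, huv⟩ := had
    have hab : a % 3 = 0 ∧ d % 3 = 0 := by
      have h1 : a % 3 = 0 ∨ a % 3 = 1 ∨ a % 3 = 2 := by omega
      have h2 : d % 3 = 0 ∨ d % 3 = 1 ∨ d % 3 = 2 := by omega
      rcases h1 with h1 | h1 | h1 <;> rcases h2 with h2 | h2 | h2 <;>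
        simp [pow_two, Int.add_emod, Int.mul_emod, h1, h2] at h3 ⊢
    have := congrArg (· % 3) huv
    simp [Int.add_emod, Int.mul_emod, hab.1, hab.2] at this

/-- Here the triple is `z ^ 2 + (x * y) ^ 2 = (x ^ 2 + y ^ 2) ^ 2`. -/
theorem Int.quartic_plus_descent (N : ℕ) : ∀ x y z : ℤ, x.natAbs = N → x ≠ 0 → x % 2 = 0 →
    IsCoprime x y → x ^ 4 + x ^ 2 * y ^ 2 + y ^ 4 ≠ z ^ 2 := by
  induction N using Nat.strong_induction_on with
  | _ N ih =>
  intro x y z hN hx hx2 hxy hz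
  -- The cases `k = -1` and `k = 3` both reach this system: `q ^ 2 + (2 * v) ^ 2 = p ^ 2` gives `v =
  -- R * S`, and `u ^ 2 = q ^ 2 + 3 * v ^ 2` is the quartic in `R`, `S`.
  have descent : ∀ u v p q t : ℤ, x = 2 * (v * t) → IsCoprime u v → q % 2 = 1 →
      u ^ 2 + v ^ 2 = p ^ 2 → u ^ 2 - 3 * v ^ 2 = q ^ 2 → False := by
    intro u v p q t hv huv hq hp hq'
    have hqv : IsCoprime (q ^ 2) v :=
      (huv.pow_left (m := 2)).of_eq_add_mul (-3 * v) (by rw [← hq']; ring)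
    have hq2 : IsCoprime q (2 * v) := by
      refine IsCoprime.mul_right ?_ ((IsCoprime.pow_left_iff (by norm_num)).1 hqv)
      exact ⟨1, -(q / 2), by have := Int.emod_add_mul_ediv q 2; linarith⟩
    obtain ⟨R, S, e1, e2, -, hRS, hpar⟩ := Int.exists_parametrization_of_sq_add_sq
      (p := q) (q := 2 * v) (r := p) (by linear_combination hp - hq') hq2 hq
    obtain rfl : v = R * S := by linarith
    have hRS0 : R * S ≠ 0 := by rintro h; simp [h] at hv; exact hx hv
    rw [e1] at hq'
    rcases hpar with ⟨h, -⟩ | ⟨-, h⟩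
    · refine ih R.natAbs ?_ R S u rfl (left_ne_zero_of_mul hRS0) h hRS ?_
      · rw [← hN]; exact Int.natAbs_lt_of_eq_mul (t := S * t) hx (by rw [hv]; ring)
      · linear_combination -hq'
    · refine ih S.natAbs ?_ S R u rfl (right_ne_zero_of_mul hRS0) h hRS.symm ?_
      · rw [← hN]; exact Int.natAbs_lt_of_eq_mul (t := R * t) hx (by rw [hv]; ring)
      · linear_combination -hq'
  obtain ⟨w, rfl⟩ : ∃ w, x = 2 * w := ⟨x / 2, by omega⟩
  obtain ⟨hwy, hy⟩ := Int.isCoprime_of_two_mul hxy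
  have hw : w ≠ 0 := by rintro rfl; simp at hx
  have hcop : IsCoprime z (2 * w * y) := by
    refine (IsCoprime.pow_left_iff (m := 2) (by norm_num)).1 ?_
    rw [← hz]
    refine IsCoprime.mul_right ?_ ?_
    · exact (hxy.symm.pow_left (m := 4)).of_eq_add_mul ((2 * w) ^ 3 + (2 * w) * y ^ 2) (by ring)
    · exact (hxy.pow_left (m := 4)).of_eq_add_mul (y ^ 3 + y * (2 * w) ^ 2) (by ring)
  have hodd : z % 2 = 1 := by
    have h1 := Int.sq_emod_four (y ^ 2)
    have h3 := Int.sq_emod_four y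
    have h4 := Int.sq_emod_four z
    have h2 : z ^ 2 = 2 * (8 * w ^ 4 + 2 * w ^ 2 * y ^ 2) + (y ^ 2) ^ 2 := by
      rw [← hz]; ring
    omega
  obtain ⟨m, n, -, h2, h1, hmn, -⟩ := Int.exists_parametrization_of_sq_add_sq
    (r := (2 * w) ^ 2 + y ^ 2) (by linear_combination -hz) hcop hodd
  replace h1 : (2 * w) ^ 2 + y ^ 2 = m ^ 2 + n ^ 2 :=
    (sq_eq_sq₀ (by positivity) (by positivity)).1 h1
  obtain ⟨a, b, c, d, rfl, rfl, rfl, rfl⟩ :=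
    Int.exists_common_refinement (x := w) (y := y) (m := m) (n := n) hw
      (by linarith)
  have hbc : IsCoprime (c ^ 2) (b ^ 2) :=
    (hwy.of_mul_left_right.of_mul_right_left.symm).pow
  have had : IsCoprime a d := hwy.of_mul_left_left.of_mul_right_right
  have key : b ^ 2 * (4 * a ^ 2 + (-1) * d ^ 2) = c ^ 2 * (a ^ 2 + (-1) * d ^ 2) := by
    linear_combination h1
  obtain ⟨k, hk⟩ := hbc.dvd_of_dvd_mul_left (Dvd.intro _ key.symm)
  rw [mul_comm (c ^ 2) k] at hk
  have hc : c ≠ 0 := by rintro rfl; simp at hy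
  have hk' : a ^ 2 + (-1) * d ^ 2 = k * b ^ 2 := by
    refine mul_left_cancel₀ (pow_ne_zero 2 hc) ?_
    rw [← key, hk]; ring
  have hd : d % 2 = 1 := by
    rcases Int.emod_two_eq_zero_or_one d with h | h
    · simp [Int.mul_emod, h] at hy
    · exact h
  have hc2 : c % 2 = 1 := by
    rcases Int.emod_two_eq_zero_or_one c with h | h
    · simp [Int.mul_emod, h] at hy
    · exact h
  have hd4 := Int.sq_emod_four d
  have hc4 := Int.sq_emod_four c
  rcases Int.eq_of_dvd_three (Int.dvd_three_of_quadratic_forms (-1) had hk hk' (by norm_num))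
    with rfl | rfl | rfl | rfl
  -- With `c`, `d` odd, `k = 1` fails mod 4, as does `k = -3` below.
  · omega
  · have hba : IsCoprime b a := by
      refine (IsCoprime.pow_left_iff (m := 2) (by norm_num)).1 ?_
      exact (had.symm.pow_left (m := 2)).of_eq_add_mul (-a) (by linear_combination hk')
    exact descent b a d c b (by ring) hba hc2 (by linear_combination hk')
      (by linear_combination hk' - hk)
  · have hba : IsCoprime (-3 * b ^ 2) a :=
      (had.symm.pow_left (m := 2)).of_eq_add_mul (-a) (by linear_combination hk')
    replace hba := ((IsCoprime.pow_left_iff (by norm_num)).1 hba.of_mul_left_right).symm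
    exact descent a b c d a (by ring) hba hd (by linarith)
      (by linear_combination hk')
  · omega
/-- A coprime solution of `x ^ 4 + x ^ 2 y ^ 2 + y ^ 4 = z ^ 2` is trivial. -/
theorem Int.quartic_plus_eq_zero {x y z : ℤ} (hxy : IsCoprime x y)
    (h : x ^ 4 + x ^ 2 * y ^ 2 + y ^ 4 = z ^ 2) : x = 0 ∨ y = 0 := by
  by_contra! h0
  rcases Int.emod_two_eq_zero_or_one x with hx | hx
  · exact Int.quartic_plus_descent _ x y z rfl h0.1 hx hxy h
  rcases Int.emod_two_eq_zero_or_one y with hy | hy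
  · exact Int.quartic_plus_descent _ y x z rfl h0.2 hy hxy.symm (by rw [← h]; ring)
  have hx4 : x % 4 = 1 ∨ x % 4 = 3 := by omega
  have hy4 : y % 4 = 1 ∨ y % 4 = 3 := by omega
  have hz : z ^ 2 % 4 = 3 := by
    rw [← h]
    rcases hx4 with hx4 | hx4 <;> rcases hy4 with hy4 | hy4 <;>
      simp [pow_succ, Int.add_emod, Int.mul_emod, hx4, hy4]
  have := Int.sq_emod_four z
  omega

theorem Int.quartic_minus_of_even {x y z : ℤ} (hxy : IsCoprime x y)
    (hpar : x % 2 = 0 ∨ y % 2 = 0)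
    (h : x ^ 4 - x ^ 2 * y ^ 2 + y ^ 4 = z ^ 2) : x = 0 ∨ y = 0 := by
  by_contra! h0
  rcases hpar with hx | hy
  · exact Int.quartic_minus_descent _ x y z rfl h0.1 hx hxy h
  · exact Int.quartic_minus_descent _ y x z rfl h0.2 hy hxy.symm (by rw [← h]; ring)

/-- A coprime solution of `x ^ 4 - x ^ 2 y ^ 2 + y ^ 4 = z ^ 2` is trivial. -/
theorem Int.quartic_minus_trivial {x y z : ℤ} (hxy : IsCoprime x y)
    (h : x ^ 4 - x ^ 2 * y ^ 2 + y ^ 4 = z ^ 2) : x = 0 ∨ y = 0 ∨ x ^ 2 = y ^ 2 := by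
  by_cases hpar : x % 2 = 0 ∨ y % 2 = 0
  · exact (Int.quartic_minus_of_even hxy hpar h).imp_right Or.inl
  have hodd : x * y % 2 = 1 := by
    have hx : x % 2 = 1 := by omega
    have hy : y % 2 = 1 := by omega
    simp [Int.mul_emod, hx, hy]
  have hcop : IsCoprime (x * y) (x ^ 2 - y ^ 2) := by
    refine IsCoprime.symm (IsCoprime.mul_right ?_ ?_)
    · exact (hxy.symm.neg_left.mul_left hxy.symm).of_eq_add_mul x (by ring)
    · exact (hxy.mul_left hxy).of_eq_add_mul (-y) (by ring)
  obtain ⟨m, n, h1, h2, -, hmn, hpar'⟩ := Int.exists_parametrization_of_sq_add_sq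
    (r := z) (by linear_combination h) hcop hodd
  -- For `x`, `y` odd, `m` and `n` solve the same quartic with opposite parities, so one of them
  -- vanishes.
  have h3 : 4 * (m ^ 4 - m ^ 2 * n ^ 2 + n ^ 4) = (x ^ 2 + y ^ 2) ^ 2 := by
    linear_combination -4 * (x * y + m ^ 2 - n ^ 2) * h1 - (x ^ 2 - y ^ 2 + 2 * m * n) * h2
  obtain ⟨w, hw⟩ : (2 : ℤ) ∣ x ^ 2 + y ^ 2 := by
    have h4 := Int.sq_emod_four x
    have h5 := Int.sq_emod_four y
    omega
  rw [hw] at h3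
  rcases Int.quartic_minus_of_even (z := w) hmn (by omega) (by linarith) with rfl | rfl <;>
    exact Or.inr (Or.inr (by linear_combination h2))

/-! ### Rational consequences for nice parameters -/

theorem Rat.quartic_plus_eq_zero {s : ℚ} (h : IsSquare (s ^ 4 + s ^ 2 + 1)) : s = 0 := by
  have h1 : IsSquare (((s.num ^ 4 + s.num ^ 2 * (s.den : ℤ) ^ 2 + (s.den : ℤ) ^ 4 : ℤ)) : ℚ) := by
    obtain ⟨r, hr⟩ := h
    refine ⟨r * s.den ^ 2, ?_⟩
    have : (s.num : ℚ) = s * s.den := (Rat.mul_den_eq_num s).symm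
    push_cast
    rw [this]
    linear_combination (s.den : ℚ) ^ 4 * hr
  obtain ⟨z, hz⟩ := Rat.isSquare_intCast_iff.1 h1
  rcases Int.quartic_plus_eq_zero (Rat.isCoprime_num_den s) (hz.trans (sq z).symm) with h | h
  · exact Rat.num_eq_zero.1 h
  · exact absurd h (by exact_mod_cast s.den_ne_zero)

theorem Rat.quartic_minus_trivial {s : ℚ} (h : IsSquare (s ^ 4 - s ^ 2 + 1)) :
    s = 0 ∨ s ^ 2 = 1 := by
  have h0 : (s.num : ℚ) = s * s.den := (Rat.mul_den_eq_num s).symm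
  have hd : (s.den : ℚ) ≠ 0 := by exact_mod_cast s.den_ne_zero
  have h1 : IsSquare (((s.num ^ 4 - s.num ^ 2 * (s.den : ℤ) ^ 2 + (s.den : ℤ) ^ 4 : ℤ)) : ℚ) := by
    obtain ⟨r, hr⟩ := h
    refine ⟨r * s.den ^ 2, ?_⟩
    push_cast
    rw [h0]
    linear_combination (s.den : ℚ) ^ 4 * hr
  obtain ⟨z, hz⟩ := Rat.isSquare_intCast_iff.1 h1
  rcases Int.quartic_minus_trivial (Rat.isCoprime_num_den s) (hz.trans (sq z).symm) with h | h | h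
  · exact Or.inl (Rat.num_eq_zero.1 h)
  · exact absurd h (by exact_mod_cast s.den_ne_zero)
  · right
    have h2 : (s.num : ℚ) ^ 2 = (s.den : ℚ) ^ 2 := by exact_mod_cast h
    rw [h0] at h2
    exact mul_right_cancel₀ (pow_ne_zero 2 hd) (by linear_combination h2)
namespace IsNiceParameter

variable {L : ℚ}

theorem not_isSquare (hL : IsNiceParameter L) : ¬ IsSquare L := by
  rintro ⟨s, rfl⟩
  obtain ⟨h0, h1, h2⟩ := hL
  rcases Rat.quartic_minus_trivial (s := s) (by convert h2 using 1; ring) with h | h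
  · exact h0 (by simp [h])
  · exact h1 (by rw [← sq, h])

theorem not_isSquare_neg (hL : IsNiceParameter L) : ¬ IsSquare (-L) := by
  rintro ⟨s, hs⟩
  obtain ⟨h0, -, h2⟩ := hL
  obtain rfl : L = -(s * s) := by rw [← hs, neg_neg]
  have := Rat.quartic_plus_eq_zero (s := s) (by convert h2 using 1; ring)
  exact h0 (by simp [this])

theorem one_sub (hL : IsNiceParameter L) : IsNiceParameter (1 - L) := by
  obtain ⟨h0, h1, h2⟩ := hL
  refine ⟨sub_ne_zero.2 h1.symm, by simpa using h0, ?_⟩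
  convert h2 using 1; ring

theorem inv (hL : IsNiceParameter L) : IsNiceParameter L⁻¹ := by
  obtain ⟨h0, h1, r, h2⟩ := hL
  refine ⟨inv_ne_zero h0, by simpa using h1, r / L, ?_⟩
  field_simp
  linear_combination h2

theorem not_isSquare_one_sub (hL : IsNiceParameter L) : ¬ IsSquare (1 - L) :=
  hL.one_sub.not_isSquare

theorem not_isSquare_sq_sub (hL : IsNiceParameter L) : ¬ IsSquare (L ^ 2 - L) := by
  rintro ⟨r, hr⟩
  refine hL.inv.one_sub.not_isSquare ⟨r / L, ?_⟩
  have := hL.1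
  field_simp
  linear_combination hr

end IsNiceParameter

/-! ### Squares in quadratic extensions -/

section QuadraticExtension

variable {K : Type*} [Field K] [Algebra ℚ K]

theorem isSquare_of_mem_range_algebraMap {d : ℚ} {α : K} (hα : α ^ 2 = algebraMap ℚ K d)
    (h : α ∈ Set.range (algebraMap ℚ K)) : IsSquare d := by
  obtain ⟨q, rfl⟩ := h
  exact ⟨q, (algebraMap ℚ K).injective (by rw [← hα, map_mul, sq])⟩

variable [Algebra.IsQuadraticExtension ℚ K]

theorem exists_eq_add_mul_of_not_mem_range {α : K} (hα : α ∉ Set.range (algebraMap ℚ K)) (β : K) :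
    ∃ p q : ℚ, β = algebraMap ℚ K p + algebraMap ℚ K q * α := by
  have hli : LinearIndependent ℚ ![(1 : K), α] := by
    rw [LinearIndependent.pair_iff' one_ne_zero]
    intro a ha
    exact hα ⟨a, by rw [← ha, Algebra.smul_def, mul_one]⟩
  have hspan := hli.span_eq_top_of_card_eq_finrank
    (by simp [Algebra.IsQuadraticExtension.finrank_eq_two ℚ K])
  have hβ : β ∈ Submodule.span ℚ (Set.range ![(1 : K), α]) := hspan ▸ Submodule.mem_top
  rw [Matrix.range_cons, Matrix.range_cons, Matrix.range_empty, Set.union_empty,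
    Set.singleton_union, Submodule.mem_span_pair] at hβ
  obtain ⟨p, q, h⟩ := hβ
  exact ⟨p, q, by rw [← h, Algebra.smul_def, Algebra.smul_def, mul_one]⟩

theorem isRatAdjoinSqrt_iff_isSquare {d : ℚ} (hd : ¬ IsSquare d) :
    IsRatAdjoinSqrt K d ↔ IsSquare (algebraMap ℚ K d) := by
  constructor
  · rintro ⟨α, hα, -⟩
    exact ⟨α, by rw [← hα, sq]⟩
  · rintro ⟨α, hα⟩
    have hα' : α ^ 2 = algebraMap ℚ K d := by rw [hα, sq]
    refine ⟨α, hα', eq_top_iff.2 fun β _ ↦ ?_⟩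
    obtain ⟨p, q, rfl⟩ := exists_eq_add_mul_of_not_mem_range
      (mt (isSquare_of_mem_range_algebraMap hα') hd) β
    exact add_mem (algebraMap_mem _ p) (mul_mem (algebraMap_mem _ q)
      (IntermediateField.mem_adjoin_simple_self ℚ α))

/-- A rational number that becomes a square in `ℚ(√d)` is a rational square or `d` times one. -/
theorem isSquare_or_isSquare_mul_of_isSquare_algebraMap {d e : ℚ} (hd : ¬ IsSquare d)
    (hdK : IsSquare (algebraMap ℚ K d)) (heK : IsSquare (algebraMap ℚ K e)) :
    IsSquare e ∨ IsSquare (d * e) := by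
  obtain ⟨α, hα⟩ := hdK
  obtain ⟨β, hβ⟩ := heK
  have hα' : α ∉ Set.range (algebraMap ℚ K) :=
    mt (isSquare_of_mem_range_algebraMap (by rw [hα, sq])) hd
  obtain ⟨p, q, rfl⟩ := exists_eq_add_mul_of_not_mem_range hα' β
  have hpq : p * q = 0 := by
    by_contra hpq
    -- Solve `(p + q * α) ^ 2 = e` for `α`.
    refine hα' ⟨(e - p ^ 2 - q ^ 2 * d) / (2 * (p * q)), ?_⟩
    have h : algebraMap ℚ K (2 * (p * q)) ≠ 0 := by
      rw [Ne, map_eq_zero]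
      exact mul_ne_zero two_ne_zero hpq
    rw [map_div₀, div_eq_iff h]
    simp only [map_sub, map_mul, map_pow, hβ, hα, map_ofNat]
    ring
  rcases mul_eq_zero.1 hpq with rfl | rfl
  · right
    refine ⟨q * d, (algebraMap ℚ K).injective ?_⟩
    simp only [map_mul, hβ, hα, map_zero]
    ring
  · left
    refine ⟨p, (algebraMap ℚ K).injective ?_⟩
    simp only [map_mul, hβ, map_zero]
    ring

end QuadraticExtension

/-! ### Doubling and points of order 4 -/

section NiceCurve

open WeierstrassCurve.Affine

variable {K : Type*} [Field K] [Algebra ℚ K] (L : ℚ)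

theorem niceCurve_a₁ : ((niceCurve L).baseChange K).toAffine.a₁ = 0 := map_zero _

theorem niceCurve_a₂ : ((niceCurve L).baseChange K).toAffine.a₂ = -(1 + algebraMap ℚ K L) := by
  rw [← map_one (algebraMap ℚ K), ← map_add, ← map_neg]
  rfl

theorem niceCurve_a₃ : ((niceCurve L).baseChange K).toAffine.a₃ = 0 := map_zero _

theorem niceCurve_a₄ : ((niceCurve L).baseChange K).toAffine.a₄ = algebraMap ℚ K L := rfl

theorem niceCurve_a₆ : ((niceCurve L).baseChange K).toAffine.a₆ = 0 := map_zero _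

theorem niceCurve_equation_iff (x y : K) :
    ((niceCurve L).baseChange K).toAffine.Equation x y ↔
      y ^ 2 = x * (x - 1) * (x - algebraMap ℚ K L) := by
  rw [equation_iff]
  rw [niceCurve_a₁, niceCurve_a₂, niceCurve_a₃, niceCurve_a₄, niceCurve_a₆]
  ring_nf

theorem niceCurve_negY (x y : K) : ((niceCurve L).baseChange K).toAffine.negY x y = -y := by
  simp [negY, niceCurve]

variable [DecidableEq K]

/-- For roots `e`, `e'`, `e''` of the cubic, each numerator is `(x - e) ^ 2 - (e - e') * (e - e'')`.
-/
theorem niceCurve_add_self_of_Y_ne_zero {x y : K} (hy : y ≠ 0)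
    (h : ((niceCurve L).baseChange K).toAffine.Nonsingular x y) :
    ∃ (X Y : K) (h' : ((niceCurve L).baseChange K).toAffine.Nonsingular X Y),
      Point.some x y h + Point.some x y h = Point.some X Y h' ∧
      X = ((x ^ 2 - algebraMap ℚ K L) / (2 * y)) ^ 2 ∧
      X - 1 = ((x ^ 2 - 2 * x + algebraMap ℚ K L) / (2 * y)) ^ 2 ∧
      X - algebraMap ℚ K L =
        ((x ^ 2 - 2 * algebraMap ℚ K L * x + algebraMap ℚ K L) / (2 * y)) ^ 2 := by
  have : CharZero K := algebraRat.charZero K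
  have h2 : (2 : K) ≠ 0 := two_ne_zero
  have hy' : y ≠ ((niceCurve L).baseChange K).toAffine.negY x y := by
    rw [niceCurve_negY]
    intro h
    exact hy ((mul_eq_zero.1 (by linear_combination h : 2 * y = 0)).resolve_left h2)
  have hE := (niceCurve_equation_iff L x y).1 h.1
  refine ⟨_, _, _, Point.add_self_of_Y_ne hy', ?_⟩
  have hX : ((niceCurve L).baseChange K).toAffine.addX x x
      (((niceCurve L).baseChange K).toAffine.slope x x y y) =
      ((3 * x ^ 2 - 2 * (1 + algebraMap ℚ K L) * x + algebraMap ℚ K L) / (2 * y)) ^ 2 +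
        (1 + algebraMap ℚ K L) - 2 * x := by
    rw [slope_of_Y_ne rfl hy', niceCurve_negY, addX]
    rw [niceCurve_a₁, niceCurve_a₂, niceCurve_a₄]
    rw [sub_neg_eq_add y y, ← two_mul y]
    ring
  rw [hX]
  refine ⟨?_, ?_, ?_⟩ <;> field_simp <;> grind

theorem niceCurve_isSquare_of_addOrderOf_eq_four
    {P : ((niceCurve L).baseChange K).toAffine.Point} (hP : addOrderOf P = 4) :
    IsSquare (-1 : K) ∧ IsSquare (algebraMap ℚ K (-L)) ∨
      IsSquare (algebraMap ℚ K (1 - L)) ∨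
      IsSquare (algebraMap ℚ K L) ∧ IsSquare (algebraMap ℚ K (L - 1)) := by
  have : CharZero K := algebraRat.charZero K
  have hP2 : P + P ≠ 0 := by
    rw [← two_nsmul]
    intro h
    have := addOrderOf_dvd_of_nsmul_eq_zero h
    rw [hP] at this
    omega
  have hP4 : (P + P) + (P + P) = 0 := by
    have h := addOrderOf_nsmul_eq_zero P
    rwa [hP, show 4 = 2 * 2 from rfl, mul_nsmul, two_nsmul, two_nsmul] at h
  rcases P with _ | ⟨x, y, h⟩
  · exact absurd (add_zero _) hP2
  have hy : y ≠ 0 := by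
    rintro rfl
    exact hP2 (Point.add_self_of_Y_eq (by rw [niceCurve_negY, neg_zero]))
  obtain ⟨X, Y, h', hQ, e0, e1, eL⟩ := niceCurve_add_self_of_Y_ne_zero L hy h
  rw [hQ] at hP4
  have hY : Y = 0 := by
    by_contra hY
    obtain ⟨_, _, _, h4, -⟩ := niceCurve_add_self_of_Y_ne_zero L hY h'
    rw [h4] at hP4
    exact Point.some_ne_zero _ hP4
  have hE := (niceCurve_equation_iff L X Y).1 h'.1
  have s0 : IsSquare X := ⟨_, e0.trans (sq _)⟩
  have s1 : IsSquare (X - 1) := ⟨_, e1.trans (sq _)⟩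
  have sL : IsSquare (X - algebraMap ℚ K L) := ⟨_, eL.trans (sq _)⟩
  rw [hY, zero_pow two_ne_zero, eq_comm, mul_eq_zero, mul_eq_zero] at hE
  rcases hE with (hX | hX) | hX
  · left
    rw [hX, zero_sub] at s1 sL
    exact ⟨s1, by rwa [map_neg]⟩
  · right; left
    rw [sub_eq_zero.1 hX] at sL
    rwa [map_sub, map_one]
  · right; right
    rw [sub_eq_zero.1 hX] at s0 s1
    exact ⟨s0, by rwa [map_sub, map_one]⟩

theorem niceCurve_exists_addOrderOf_eq_four (h0 : L ≠ 0) (h1 : L ≠ 1)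
    (h : IsSquare (algebraMap ℚ K (1 - L))) :
    ∃ P : ((niceCurve L).baseChange K).toAffine.Point, addOrderOf P = 4 := by
  have : CharZero K := algebraRat.charZero K
  obtain ⟨t, ht⟩ := h
  rw [map_sub, map_one] at ht
  have hL : algebraMap ℚ K L = 1 - t * t := by rw [← ht]; ring
  have hL0 : 1 - t * t ≠ 0 := by rw [← hL]; simpa using h0
  have ht0 : t ≠ 0 := by
    rintro rfl
    exact h1 ((algebraMap ℚ K).injective (by rw [hL]; simp))
  have ht1 : 1 + t ≠ 0 := by
    intro h
    exact hL0 (by linear_combination (1 - t) * h)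
  have hy : t * (1 + t) ≠ 0 := mul_ne_zero ht0 ht1
  -- The abscissa `1 + t` is a root of `x ^ 2 - 2 * x + L`, the numerator whose vanishing sends the
  -- double to `(1, 0)`.
  have hE : ((niceCurve L).baseChange K).toAffine.Nonsingular (1 + t) (t * (1 + t)) := by
    rw [nonsingular_iff', niceCurve_equation_iff]
    refine ⟨by rw [hL]; ring, Or.inr ?_⟩
    simpa [niceCurve] using And.intro ht0 ht1
  obtain ⟨X, Y, h', hQ, -, e1, -⟩ := niceCurve_add_self_of_Y_ne_zero L hy hE
  have hX : X - 1 = 0 := by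
    rw [e1, hL]
    ring_nf
  have hY : Y = 0 := by
    have := (niceCurve_equation_iff L X Y).1 h'.1
    rw [hX, mul_zero, zero_mul] at this
    exact pow_eq_zero_iff two_ne_zero |>.1 this
  refine ⟨Point.some _ _ hE, addOrderOf_eq_prime_pow (p := 2) (n := 1) ?_ ?_⟩
  · rw [pow_one, two_nsmul, hQ]
    exact Point.some_ne_zero _
  · rw [pow_succ, pow_one, mul_nsmul, two_nsmul, two_nsmul, hQ]
    exact Point.add_self_of_Y_eq (by rw [niceCurve_negY, hY, neg_zero])

end NiceCurve

theorem mainTheorem5 (L : ℚ) (hL : IsNiceParameter L) :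
    (¬ IsSquare L ∧ ¬ IsSquare (1 - L) ∧ ¬ IsSquare (L ^ 2 - L)) ∧
    ∀ (K : Type*) [Field K] [DecidableEq K] [Algebra ℚ K] [Algebra.IsQuadraticExtension ℚ K],
      (∃ P : ((niceCurve L).baseChange K).toAffine.Point, addOrderOf P = 4) ↔
        IsRatAdjoinSqrt K (1 - L) := by
  refine ⟨⟨hL.not_isSquare, hL.not_isSquare_one_sub, hL.not_isSquare_sq_sub⟩, ?_⟩
  intro K _ _ _ _
  rw [isRatAdjoinSqrt_iff_isSquare hL.not_isSquare_one_sub]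
  refine ⟨?_, niceCurve_exists_addOrderOf_eq_four L hL.1 hL.2.1⟩
  rintro ⟨P, hP⟩
  rcases niceCurve_isSquare_of_addOrderOf_eq_four L hP with ⟨h1, h2⟩ | h | ⟨h1, h2⟩
  · have hneg : ¬ IsSquare (-1 : ℚ) := fun h ↦ absurd h.nonneg (by norm_num)
    rcases isSquare_or_isSquare_mul_of_isSquare_algebraMap hneg
      (by rwa [map_neg, map_one]) h2 with h | h
    · exact absurd h hL.not_isSquare_neg
    · exact absurd (by simpa using h) hL.not_isSquare
  · exact h
  · rcases isSquare_or_isSquare_mul_of_isSquare_algebraMap hL.not_isSquare h1 h2 with h | h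
    · exact absurd (by rwa [neg_sub]) hL.one_sub.not_isSquare_neg
    · exact absurd (by convert h using 1; ring) hL.not_isSquare_sq_sub
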